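/- Let $F$ be a free group of finite rank with basis $\{x_1,\dots,x_m\}$, let $e_1,\dots,e_m\ge 0$ be integers with $e_m\mid e_{m-1}\mid\cdots\mid e_1$, and let $S=\langle x_1^{e_1},\dots,x_m^{e_m},\gamma_2(F)\rangle$, where $\gamma_1(G)=G$, $\gamma_{n+1}(G)=[\gamma_n(G),G]$ denotes the lower central series of a group $G$. Let $\mathfrak f$ be the augmentation ideal of the integral group ring $\mathbb Z[F]$, let $\mathfrak s=(S-1)\mathbb Z[F]$ be the two-sided ideal generated by all $s-1$, $s\in S$, and for a two-sided ideal $\mathfrak a$ of $\mathbb Z[F]$ put $D(n,\mathfrak a)=F\cap(1+\mathfrak a+\mathfrak f^n)$. Then the natural map $$\theta:\ D(4,\mathfrak f\mathfrak s)/\gamma_2(S)\gamma_4(F)\ \to\ D(3,\mathfrak f\mathfrak s)/\gamma_2(S)\gamma_3(F)$$ induced by the inclusion $D(4,\mathfrak f\mathfrak s)\subseteq D(3,\mathfrak f\mathfrak s)$ is a monomorphism, its image is a normal subgroup, and its cokernel is an elementary abelian $2$-group (possibly trivial), that is, an abelian group in which every element has square $1$. -/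

import Mathlib

open scoped commutatorElement

namespace GenDim

noncomputable section

/-- `gamma F n` is the `n`-th term `γ_n(F)` of the lower central series, `γ_1(F) = F`,
`γ_{n+1}(F) = [γ_n(F), F]`. (Mathlib's series starts at index `0`; only `n ≥ 1` is meaningful.) -/
def gamma (F : Type*) [Group F] (n : ℕ) : Subgroup F :=
  (⊤ : Subgroup F).lowerCentralSeries (n - 1)

instance gamma_normal (F : Type*) [Group F] (n : ℕ) : (gamma F n).Normal := by
  unfold gamma; infer_instance

/-- The augmentation ideal `𝔣` of `ℤ[F]`: the kernel of the ring homomorphism `ℤ[F] → ℤ` that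
sends every group element to `1`. -/
def augIdeal (F : Type*) [Group F] : Ideal (MonoidAlgebra ℤ F) :=
  RingHom.ker (MonoidAlgebra.lift ℤ ℤ F (1 : F →* ℤ))

instance augIdeal_isTwoSided (F : Type*) [Group F] : (augIdeal F).IsTwoSided := by
  unfold augIdeal; infer_instance

/-- The ideal `𝔰 = ℤ[F](S - 1)` of `ℤ[F]` generated by the elements `s - 1`, `s ∈ S`.
It is two-sided when `S` is normal in `F`, see `relIdeal_isTwoSided`. -/
def relIdeal {F : Type*} [Group F] (S : Subgroup F) : Ideal (MonoidAlgebra ℤ F) :=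
  Ideal.span {a | ∃ s ∈ S, a = MonoidAlgebra.of ℤ F s - 1}

theorem sub_one_mem_relIdeal {F : Type*} [Group F] {S : Subgroup F} {s : F} (hs : s ∈ S) :
    MonoidAlgebra.of ℤ F s - 1 ∈ relIdeal S :=
  Ideal.subset_span ⟨s, hs, rfl⟩

instance relIdeal_isTwoSided {F : Type*} [Group F] (S : Subgroup F) [hS : S.Normal] :
    (relIdeal S).IsTwoSided := by
  refine ⟨fun {a} b ha => ?_⟩
  induction b using MonoidAlgebra.induction_on with
  | of g =>
    refine Submodule.span_induction (p := fun a _ => a * MonoidAlgebra.of ℤ F g ∈ relIdeal S)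
      ?_ ?_ ?_ ?_ ha
    · rintro _ ⟨s, hs, rfl⟩
      have h1 : g⁻¹ * s * g ∈ S := by simpa using hS.conj_mem s hs g⁻¹
      have h2 : (MonoidAlgebra.of ℤ F s - 1) * MonoidAlgebra.of ℤ F g
          = MonoidAlgebra.of ℤ F g * (MonoidAlgebra.of ℤ F (g⁻¹ * s * g) - 1) := by
        rw [mul_sub, sub_mul, ← map_mul, ← map_mul]
        simp [mul_assoc]
      rw [h2]
      exact Ideal.mul_mem_left _ _ (sub_one_mem_relIdeal h1)
    · simp
    · intro x y _ _ hx hy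
      rw [add_mul]; exact add_mem hx hy
    · intro r x _ hx
      rw [smul_eq_mul, mul_assoc]; exact Ideal.mul_mem_left _ _ hx
  | add x y hx hy => rw [mul_add]; exact add_mem hx hy
  | smul r x hx => rw [mul_smul_comm]; exact zsmul_mem hx r

/-- The generalized dimension subgroup `D(n, 𝔞) = F ∩ (1 + 𝔞 + 𝔣ⁿ)`. -/
def D {F : Type*} [Group F] (n : ℕ) (a : Ideal (MonoidAlgebra ℤ F)) : Subgroup F where
  carrier := {w | MonoidAlgebra.of ℤ F w - 1 ∈ a ⊔ augIdeal F ^ n}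
  one_mem' := by
    have h : MonoidAlgebra.of ℤ F 1 - 1 = 0 := by rw [map_one, sub_self]
    rw [Set.mem_ofPred_eq, h]
    exact zero_mem _
  mul_mem' := by
    intro u v hu hv
    have h : MonoidAlgebra.of ℤ F (u * v) - 1
        = MonoidAlgebra.of ℤ F u * (MonoidAlgebra.of ℤ F v - 1)
          + (MonoidAlgebra.of ℤ F u - 1) := by
      rw [map_mul]; noncomm_ring
    simp only [Set.mem_ofPred_eq] at hu hv ⊢
    rw [h]
    exact add_mem (Ideal.mul_mem_left _ _ hv) hu
  inv_mem' := by
    intro u hu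
    have h : MonoidAlgebra.of ℤ F u⁻¹ - 1
        = (-MonoidAlgebra.of ℤ F u⁻¹) * (MonoidAlgebra.of ℤ F u - 1) := by
      rw [mul_sub, neg_mul, ← map_mul]; simp; abel
    simp only [Set.mem_ofPred_eq] at hu ⊢
    rw [h]
    exact Ideal.mul_mem_left _ _ hu

theorem mem_D {F : Type*} [Group F] {n : ℕ} {a : Ideal (MonoidAlgebra ℤ F)} {w : F} :
    w ∈ D n a ↔ MonoidAlgebra.of ℤ F w - 1 ∈ a ⊔ augIdeal F ^ n := Iff.rfl

/-- `S = ⟨x_1^{e_1}, …, x_m^{e_m}, γ_2(F)⟩`. -/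
def subS {F : Type*} [Group F] {m : ℕ} (x : Fin m → F) (e : Fin m → ℕ) : Subgroup F :=
  Subgroup.closure (Set.range fun i => x i ^ e i) ⊔ gamma F 2

theorem gamma_two (F : Type*) [Group F] : gamma F 2 = commutator F :=
  Subgroup.top_lowerCentralSeries_one

instance subS_normal {F : Type*} [Group F] {m : ℕ} (x : Fin m → F) (e : Fin m → ℕ) :
    (subS x e).Normal := by
  have h : commutator F ≤ subS x e := (gamma_two F).symm.le.trans le_sup_right
  exact Subgroup.Normal.of_commutator_le F h

/-- The subgroup `γ_2(S)γ_n(F)` of `F`, where `γ_2(S) = [S, S]`. -/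
def denom {F : Type*} [Group F] (S : Subgroup F) (n : ℕ) : Subgroup F :=
  ⁅S, S⁆ ⊔ gamma F n

instance denom_normal {F : Type*} [Group F] (S : Subgroup F) [S.Normal] (n : ℕ) :
    (denom S n).Normal := by
  unfold denom; infer_instance

theorem of_sub_one_mem_augIdeal {F : Type*} [Group F] (g : F) :
    MonoidAlgebra.of ℤ F g - 1 ∈ augIdeal F := by
  simp [augIdeal, RingHom.mem_ker]

theorem relIdeal_le_augIdeal {F : Type*} [Group F] (S : Subgroup F) :
    relIdeal S ≤ augIdeal F := by
  refine Ideal.span_le.2 ?_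
  rintro _ ⟨s, _, rfl⟩
  exact of_sub_one_mem_augIdeal s

theorem of_commutator_sub_one {F : Type*} [Group F] (u v : F) :
    MonoidAlgebra.of ℤ F ⁅u, v⁆ - 1
      = ((MonoidAlgebra.of ℤ F u - 1) * (MonoidAlgebra.of ℤ F v - 1)
        - (MonoidAlgebra.of ℤ F v - 1) * (MonoidAlgebra.of ℤ F u - 1))
        * MonoidAlgebra.of ℤ F (u⁻¹ * v⁻¹) := by
  have h : (MonoidAlgebra.of ℤ F u - 1) * (MonoidAlgebra.of ℤ F v - 1)
        - (MonoidAlgebra.of ℤ F v - 1) * (MonoidAlgebra.of ℤ F u - 1)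
      = MonoidAlgebra.of ℤ F (u * v) - MonoidAlgebra.of ℤ F (v * u) := by
    rw [map_mul, map_mul]; noncomm_ring
  rw [h, sub_mul, ← map_mul, ← map_mul]
  have h1 : u * v * (u⁻¹ * v⁻¹) = ⁅u, v⁆ := by simp [commutatorElement_def, mul_assoc]
  have h2 : v * u * (u⁻¹ * v⁻¹) = 1 := by group
  rw [h1, h2, map_one]

/-- `γ_2(S)γ_n(F)` is contained in `D(n, 𝔣𝔰)`. -/
theorem denom_le_D {F : Type*} [Group F] (S : Subgroup F) [S.Normal] {n : ℕ} (hn : 1 ≤ n) :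
    denom S n ≤ D n (augIdeal F * relIdeal S) := by
  refine sup_le ?_ ?_
  · rw [Subgroup.commutator_le]
    intro u hu v hv
    rw [mem_D, of_commutator_sub_one]
    refine Submodule.mem_sup_left (Ideal.mul_mem_right _ _ (sub_mem ?_ ?_))
    · exact Ideal.mul_mem_mul (of_sub_one_mem_augIdeal u) (sub_one_mem_relIdeal hv)
    · exact Ideal.mul_mem_mul (of_sub_one_mem_augIdeal v) (sub_one_mem_relIdeal hu)
  · have key : ∀ k : ℕ, (⊤ : Subgroup F).lowerCentralSeries k ≤ D (k + 1) ⊥ := by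
      intro k
      induction k with
      | zero =>
        intro g _
        rw [mem_D, bot_sup_eq, zero_add, Submodule.pow_one]
        exact of_sub_one_mem_augIdeal g
      | succ k ih =>
        rw [Subgroup.lowerCentralSeries_succ, Subgroup.commutator_le]
        intro u hu v _
        have hu' := ih hu
        rw [mem_D, bot_sup_eq] at hu' ⊢
        rw [of_commutator_sub_one]
        refine Ideal.mul_mem_right _ _ (sub_mem ?_ ?_)
        · rw [Submodule.pow_succ]
          exact Ideal.mul_mem_mul hu' (of_sub_one_mem_augIdeal v)
        · rw [Ideal.IsTwoSided.pow_succ]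
          exact Ideal.mul_mem_mul (of_sub_one_mem_augIdeal v) hu'
    intro g hg
    have h := key (n - 1) hg
    rw [Nat.sub_add_cancel hn, mem_D, bot_sup_eq] at h
    exact Submodule.mem_sup_right h

theorem D_four_le_three {F : Type*} [Group F] (a : Ideal (MonoidAlgebra ℤ F)) :
    D 4 a ≤ D 3 a := fun _ hw =>
  sup_le_sup_left (Ideal.pow_le_pow_right (by norm_num : 3 ≤ 4)) a hw

theorem denom_four_le_three {F : Type*} [Group F] (S : Subgroup F) :
    denom S 4 ≤ denom S 3 :=
  sup_le_sup_left (Subgroup.lowerCentralSeries_antitone _ (by norm_num : 3 - 1 ≤ 4 - 1)) _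

/-- The quotient group `D(n, 𝔣𝔰) / γ_2(S)γ_n(F)`. For `n ≥ 1` the denominator lies in the
numerator by `denom_le_D`, so `subgroupOf` loses nothing. -/
abbrev DQuot {F : Type*} [Group F] (S : Subgroup F) [S.Normal] (n : ℕ) : Type _ :=
  D n (augIdeal F * relIdeal S) ⧸
    (denom S n).subgroupOf (D n (augIdeal F * relIdeal S))

/-- The natural map `θ : D(4, 𝔣𝔰)/γ_2(S)γ_4(F) → D(3, 𝔣𝔰)/γ_2(S)γ_3(F)` induced by the inclusion
`D(4, 𝔣𝔰) ≤ D(3, 𝔣𝔰)`. -/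
def theta {F : Type*} [Group F] (S : Subgroup F) [S.Normal] : DQuot S 4 →* DQuot S 3 :=
  QuotientGroup.map _ _ (Subgroup.inclusion (D_four_le_three (augIdeal F * relIdeal S)))
    (fun _ hw => denom_four_le_three S hw)

/-- The cokernel of a homomorphism of groups: the quotient by the normal closure of the image. -/
abbrev Coker {G H : Type*} [Group G] [Group H] (f : G →* H) : Type _ :=
  H ⧸ Subgroup.normalClosure (f.range : Set H)

/-- An elementary abelian `2`-group (possibly trivial): commutative, and all squares are `1`. -/
def IsElementaryAbelianTwo (G : Type*) [Group G] : Prop :=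
  (∀ a b : G, a * b = b * a) ∧ ∀ a : G, a ^ 2 = 1

end

end GenDim

namespace GenDim

/-! Normalise the Fox derivatives `∂ⱼ` by `∂ⱼ(ab) = ε(a)∂ⱼ(b) + ∂ⱼ(a)b`. They are then right linear
on `𝔣`, so `∂ⱼ` maps `𝔣𝔰 + 𝔣ⁿ⁺¹` into `𝔰 + 𝔣ⁿ`. An additive functional killing `𝔰` and `𝔣ⁿ`
therefore gives, after composition with `∂ⱼ`, a congruence satisfied by every `w ∈ D(n+1, 𝔣𝔰)`.

Injectivity: since `γ₂(S) ⊆ D(4, 𝔣𝔰)`, it is enough to treat `w ∈ γ₃(F) ∩ D(4, 𝔣𝔰)`. Modulo `γ₄(F)`,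
`w` is a product of powers of the basic commutators `[[xⱼ, xᵢ], xₖ]` with `i < j`, `i ≤ k`. A
functional reading the coefficient of `XᵢXₖ` in the symmetric square
(`exists_quadratic_functional`), composed with `∂ⱼ`, isolates one exponent and shows that `eₖ`
divides it. But `[[xⱼ, xᵢ], xₖ]` to the power `eₖ` is congruent to `[[xⱼ, xᵢ], xₖ^eₖ] ∈ γ₂(S)`, so
`w ∈ γ₂(S)γ₄(F)` (`mem_denom_of_mem_gamma_three`).

Cokernel: `D(3, 𝔣𝔰) ⊆ γ₂(F)`, so the target of `θ` is abelian and its subgroups are normal. For `w ∈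
D(3, 𝔣𝔰)` the exponent of `[xⱼ, xᵢ]`, `i < j`, is `ε∂ᵢ∂ⱼ(w - 1)`, which `eᵢ` divides. Modulo
`γ₃(F)`, `w²` is thus a product of powers of the elements `[xⱼ, xᵢ^eᵢ]²`, and these lie in `D(4,
𝔣𝔰)` (`sq_commutator_mem_D`). The square is what absorbs the denominator of the binomial coefficient
`eᵢ(eᵢ - 1)/2`. -/

theorem closure_range_freeGroupBasis {ι F : Type*} [Group F] (x : FreeGroupBasis ι F) :
    Subgroup.closure (Set.range x) = ⊤ := by
  have h : Set.range x = x.repr.symm.toMonoidHom '' Set.range FreeGroup.of := by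
    rw [← Set.range_comp]; rfl
  rw [h, ← MonoidHom.map_closure, FreeGroup.closure_range_of, ← MonoidHom.range_eq_map,
    MonoidHom.range_eq_top]
  exact x.repr.symm.surjective

/-! ### Additive functionals on the integral group ring. -/

section GroupRing

variable {F : Type*} [Group F]

local notation "gr" => MonoidAlgebra.of ℤ F

/-- The augmentation `ℤ[F] → ℤ`. -/
noncomputable def aug (F : Type*) [Group F] : MonoidAlgebra ℤ F →+* ℤ :=
  (MonoidAlgebra.lift ℤ ℤ F (1 : F →* ℤ) : MonoidAlgebra ℤ F →ₐ[ℤ] ℤ)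

@[simp] theorem aug_of (w : F) : aug F (gr w) = 1 := by
  simp [aug]

theorem mem_augIdeal {a : MonoidAlgebra ℤ F} : a ∈ augIdeal F ↔ aug F a = 0 := Iff.rfl

theorem addHom_ext_of {A : Type*} [AddCommGroup A] {f g : MonoidAlgebra ℤ F →+ A}
    (h : ∀ w, f (gr w) = g (gr w)) (a : MonoidAlgebra ℤ F) : f a = g a := by
  induction a using MonoidAlgebra.induction_on with
  | of w => exact h w
  | add a b ha hb => rw [map_add, map_add, ha, hb]
  | smul r a ha => rw [map_zsmul, map_zsmul, ha]

/-- The additive map `ℤ[F] → A` extending a function `F → A`. -/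
noncomputable def addExtend {A : Type*} [AddCommGroup A] (q : F → A) :
    MonoidAlgebra ℤ F →+ A :=
  (Finsupp.liftAddHom fun w => (zmultiplesHom A (q w))).comp
    MonoidAlgebra.coeffAddEquiv.toAddMonoidHom

@[simp] theorem addExtend_of {A : Type*} [AddCommGroup A] (q : F → A) (w : F) :
    addExtend q (gr w) = q w := by
  simp [addExtend]

theorem map_eq_zero_of_mem_augIdeal {A : Type*} [AddCommGroup A] {f : MonoidAlgebra ℤ F →+ A}
    (h : ∀ w, f (gr w - 1) = 0) {a : MonoidAlgebra ℤ F} (ha : a ∈ augIdeal F) : f a = 0 := by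
  -- Such an `f` takes the same value on all group elements, so it is `f 1` times the augmentation.
  have key : f a = ((zmultiplesHom A (f 1)).comp (aug F).toAddMonoidHom) a := by
    refine addHom_ext_of (fun w => ?_) a
    have := h w
    rw [map_sub, sub_eq_zero] at this
    simp [this, -MonoidAlgebra.of_apply]
  rw [key]
  simp [mem_augIdeal.1 ha]

theorem map_eq_zero_of_mem_augIdeal_cube {A : Type*} [AddCommGroup A]
    {f : MonoidAlgebra ℤ F →+ A}
    (h : ∀ u v w, f ((gr u - 1) * (gr v - 1) * (gr w - 1)) = 0)
    {a : MonoidAlgebra ℤ F} (ha : a ∈ augIdeal F ^ 3) : f a = 0 := by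
  have h1 : ∀ u v, ∀ c ∈ augIdeal F, f ((gr u - 1) * (gr v - 1) * c) = 0 := fun u v c hc =>
    map_eq_zero_of_mem_augIdeal (f := f.comp (AddMonoidHom.mulLeft _)) (h u v) hc
  have h2 : ∀ u, ∀ c ∈ augIdeal F, ∀ b ∈ augIdeal F, f ((gr u - 1) * b * c) = 0 :=
    fun u c hc b hb => by
      have := map_eq_zero_of_mem_augIdeal
        (f := (f.comp (AddMonoidHom.mulRight c)).comp (AddMonoidHom.mulLeft (gr u - 1)))
        (fun v => h1 u v c hc) hb
      exact this
  have h3 : ∀ c ∈ augIdeal F, ∀ b ∈ augIdeal F, ∀ a ∈ augIdeal F, f (a * b * c) = 0 :=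
    fun c hc b hb a ha => by
      have := map_eq_zero_of_mem_augIdeal
        (f := (f.comp (AddMonoidHom.mulRight c)).comp (AddMonoidHom.mulRight b))
        (fun u => h2 u c hc b hb) ha
      exact this
  rw [Submodule.pow_succ] at ha
  induction ha using Submodule.mul_induction_on' with
  | mem_mul_mem a ha c hc =>
    rw [Ideal.IsTwoSided.pow_succ, Submodule.pow_one] at ha
    induction ha using Submodule.mul_induction_on' with
    | mem_mul_mem a ha b hb => exact h3 c hc b hb a ha
    | add x _ y _ hx hy => rw [add_mul, map_add, hx, hy, add_zero]
  | add x _ y _ hx hy => rw [map_add, hx, hy, add_zero]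

theorem map_eq_zero_of_mem_relIdeal {A : Type*} [AddCommGroup A] {f : MonoidAlgebra ℤ F →+ A}
    {S : Subgroup F} (h : ∀ g, ∀ s ∈ S, f (gr g * (gr s - 1)) = 0)
    {a : MonoidAlgebra ℤ F} (ha : a ∈ relIdeal S) : f a = 0 := by
  -- As `f` is only additive, the span induction has to carry all left multiples.
  suffices ∀ b, f (b * a) = 0 by simpa using this 1
  refine Submodule.span_induction (p := fun a _ => ∀ b, f (b * a) = 0) ?_ ?_ ?_ ?_ ha
  · rintro _ ⟨s, hs, rfl⟩ b
    exact addHom_ext_of (f := f.comp (AddMonoidHom.mulRight (gr s - 1))) (g := 0)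
      (fun g => h g s hs) b
  · simp
  · intro x y _ _ hx hy b
    rw [mul_add, map_add, hx, hy, add_zero]
  · intro r x _ hx b
    rw [smul_eq_mul, ← mul_assoc]; exact hx _

/-! ### Fox derivatives and exponent sums. -/

variable {ι : Type*} [DecidableEq ι]

/-- The matrices defining the Fox derivative with respect to the `j`-th basis element. -/
noncomputable def foxUnit (x : FreeGroupBasis ι F) (j l : ι) :
    (Matrix (Fin 2) (Fin 2) (MonoidAlgebra ℤ F))ˣ where
  val := !![1, if j = l then 1 else 0; 0, gr (x l)]
  inv := !![1, if j = l then -gr (x l)⁻¹ else 0; 0, gr (x l)⁻¹]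
  val_inv := by
    rw [Matrix.mul_fin_two, Matrix.one_fin_two, ← map_mul]
    split_ifs <;> simp [← MonoidAlgebra.one_def]
  inv_val := by
    rw [Matrix.mul_fin_two, Matrix.one_fin_two, ← map_mul]
    split_ifs <;> simp [← MonoidAlgebra.one_def]

/-- The matrix representation `a ↦ !![ε(a), ∂ⱼ(a); 0, a]` of `ℤ[F]`. -/
noncomputable def foxHom (x : FreeGroupBasis ι F) (j : ι) :
    MonoidAlgebra ℤ F →+* Matrix (Fin 2) (Fin 2) (MonoidAlgebra ℤ F) :=
  (MonoidAlgebra.lift ℤ _ F ((Units.coeHom _).comp (x.lift (foxUnit x j))) :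
    MonoidAlgebra ℤ F →ₐ[ℤ] Matrix (Fin 2) (Fin 2) (MonoidAlgebra ℤ F))

/-- The Fox derivative `∂ⱼ`, normalised by `∂ⱼ(ab) = ε(a)∂ⱼ(b) + ∂ⱼ(a)b`. -/
noncomputable def fox (x : FreeGroupBasis ι F) (j : ι) :
    MonoidAlgebra ℤ F →+ MonoidAlgebra ℤ F where
  toFun a := foxHom x j a 0 1
  map_zero' := by simp
  map_add' := by simp

theorem foxHom_of_basis (x : FreeGroupBasis ι F) (j l : ι) :
    foxHom x j (gr (x l)) = !![1, if j = l then 1 else 0; 0, gr (x l)] := by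
  have : x.lift (foxUnit x j) (x l) = foxUnit x j l := by
    simp [FreeGroupBasis.lift]
  simp only [foxHom, RingHom.coe_coe, MonoidAlgebra.lift_of, MonoidHom.comp_apply, this]
  rfl

theorem foxHom_of (x : FreeGroupBasis ι F) (j : ι) (w : F) :
    foxHom x j (gr w) 0 0 = 1 ∧ foxHom x j (gr w) 1 0 = 0 ∧ foxHom x j (gr w) 1 1 = gr w := by
  have hw : w ∈ Subgroup.closure (Set.range x) := by
    rw [closure_range_freeGroupBasis]; trivial
  induction hw using Subgroup.closure_induction with
  | mem w hw =>
    obtain ⟨l, rfl⟩ := hw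
    rw [foxHom_of_basis]
    simp
  | one => simp [← MonoidAlgebra.one_def]
  | mul u v _ _ hu hv =>
    obtain ⟨h1, h2, h3⟩ := hu
    obtain ⟨k1, k2, k3⟩ := hv
    rw [map_mul, map_mul]
    simp only [Matrix.mul_apply, Fin.sum_univ_two, h1, h2, h3, k1, k2, k3]
    simp
  | inv u _ hu =>
    obtain ⟨h1, h2, h3⟩ := hu
    have h : foxHom x j (gr u⁻¹) * foxHom x j (gr u) = 1 := by
      rw [← map_mul, ← map_mul, inv_mul_cancel, map_one, map_one]
    have e00 := congrFun (congrFun h 0) 0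
    have e10 := congrFun (congrFun h 1) 0
    have e11 := congrFun (congrFun h 1) 1
    simp only [Matrix.mul_apply, Fin.sum_univ_two, h1, h2, h3, mul_one, mul_zero, add_zero,
      Matrix.one_apply_eq] at e00 e10 e11
    have h10 : foxHom x j (gr u⁻¹) 1 0 = 0 := by simpa using e10
    refine ⟨e00, h10, ?_⟩
    rw [h10, zero_mul, zero_add] at e11
    calc foxHom x j (gr u⁻¹) 1 1 = foxHom x j (gr u⁻¹) 1 1 * (gr u * gr u⁻¹) := by
          rw [← map_mul, mul_inv_cancel, map_one, mul_one]
      _ = gr u⁻¹ := by rw [← mul_assoc, e11, one_mul]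

theorem fox_mul (x : FreeGroupBasis ι F) (j : ι) (a b : MonoidAlgebra ℤ F) :
    fox x j (a * b) = aug F a • fox x j b + fox x j a * b := by
  have h00 : foxHom x j a 0 0 = (aug F a : MonoidAlgebra ℤ F) :=
    addHom_ext_of (f := ((Matrix.entryAddMonoidHom _ 0 0).comp (foxHom x j).toAddMonoidHom))
      (g := ((Int.castRingHom (MonoidAlgebra ℤ F)).comp (aug F)).toAddMonoidHom)
      (fun w => by simpa [-MonoidAlgebra.of_apply] using (foxHom_of x j w).1) a
  have h11 : foxHom x j b 1 1 = b :=
    addHom_ext_of (f := ((Matrix.entryAddMonoidHom _ 1 1).comp (foxHom x j).toAddMonoidHom))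
      (g := AddMonoidHom.id _)
      (fun w => by simpa [-MonoidAlgebra.of_apply] using (foxHom_of x j w).2.2) b
  change foxHom x j (a * b) 0 1 = aug F a • foxHom x j b 0 1 + foxHom x j a 0 1 * b
  rw [map_mul, Matrix.mul_apply, Fin.sum_univ_two, h00, h11, zsmul_eq_mul]

@[simp] theorem fox_of_basis (x : FreeGroupBasis ι F) (j l : ι) :
    fox x j (gr (x l)) = if j = l then 1 else 0 := by
  change foxHom x j _ 0 1 = _
  rw [foxHom_of_basis]; simp

@[simp] theorem fox_one (x : FreeGroupBasis ι F) (j : ι) : fox x j 1 = 0 := by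
  change foxHom x j 1 0 1 = 0
  simp

theorem fox_mul_of_mem (x : FreeGroupBasis ι F) (j : ι) {a : MonoidAlgebra ℤ F}
    (ha : a ∈ augIdeal F) (b : MonoidAlgebra ℤ F) : fox x j (a * b) = fox x j a * b := by
  rw [fox_mul, mem_augIdeal.1 ha, zero_smul, zero_add]

/-- This is where the side of the normalisation matters: a left factor from `𝔣` is stripped off, and
its derivative multiplies the rest from the left. -/
theorem fox_mem_of_mem_mul (x : FreeGroupBasis ι F) (j : ι) {I : Ideal (MonoidAlgebra ℤ F)}
    {a : MonoidAlgebra ℤ F} (ha : a ∈ augIdeal F * I) : fox x j a ∈ I := by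
  induction ha using Submodule.mul_induction_on' with
  | mem_mul_mem a ha b hb => rw [fox_mul_of_mem x j ha]; exact Ideal.mul_mem_left _ _ hb
  | add a _ b _ ha hb => rw [map_add]; exact add_mem ha hb

/-- The exponent sum of the `j`-th basis element. -/
noncomputable def expSum (x : FreeGroupBasis ι F) (j : ι) (w : F) : ℤ := aug F (fox x j (gr w))

@[simp] theorem expSum_one (x : FreeGroupBasis ι F) (j : ι) : expSum x j 1 = 0 := by
  rw [expSum, map_one, fox_one, map_zero]

theorem expSum_mul (x : FreeGroupBasis ι F) (j : ι) (u v : F) :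
    expSum x j (u * v) = expSum x j u + expSum x j v := by
  rw [expSum, map_mul, fox_mul, map_add, map_mul, aug_of, aug_of, one_smul, mul_one, add_comm]
  rfl

theorem expSum_inv (x : FreeGroupBasis ι F) (j : ι) (u : F) :
    expSum x j u⁻¹ = -expSum x j u := by
  have := expSum_mul x j u⁻¹ u
  rw [inv_mul_cancel, expSum_one] at this
  linarith

@[simp] theorem expSum_basis (x : FreeGroupBasis ι F) (j l : ι) :
    expSum x j (x l) = if j = l then 1 else 0 := by
  rw [expSum, fox_of_basis]; split_ifs <;> simp

theorem expSum_npow (x : FreeGroupBasis ι F) (j : ι) (u : F) (n : ℕ) :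
    expSum x j (u ^ n) = n * expSum x j u := by
  induction n with
  | zero => simp
  | succ n ih => rw [pow_succ, expSum_mul, ih]; push_cast; ring

theorem expSum_commutator (x : FreeGroupBasis ι F) (j : ι) {u : F} (hu : u ∈ commutator F) :
    expSum x j u = 0 := by
  let f : F →* Multiplicative ℤ :=
    { toFun := fun w => Multiplicative.ofAdd (expSum x j w)
      map_one' := by simp
      map_mul' := fun u v => by rw [expSum_mul, ofAdd_add] }
  exact Abelianization.commutator_subset_ker f hu

theorem dvd_expSum_of_mem_subS {m : ℕ} (x : FreeGroupBasis (Fin m) F) (e : Fin m → ℕ) (i : Fin m)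
    {s : F} (hs : s ∈ subS x e) : (e i : ℤ) ∣ expSum x i s := by
  let H : Subgroup F :=
    { carrier := {w | (e i : ℤ) ∣ expSum x i w}
      one_mem' := by simp
      mul_mem' := fun {u v} hu hv => by
        rw [Set.mem_ofPred_eq, expSum_mul]; exact dvd_add hu hv
      inv_mem' := fun {u} hu => by
        rw [Set.mem_ofPred_eq, expSum_inv]; exact (dvd_neg).2 hu }
  have : subS x e ≤ H := by
    refine sup_le ?_ ?_
    · rw [Subgroup.closure_le]
      rintro _ ⟨l, rfl⟩
      change (e i : ℤ) ∣ expSum x i (x l ^ e l)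
      rw [expSum_npow, expSum_basis]
      split_ifs with h
      · subst h; simp
      · simp
    · intro u hu
      rw [gamma_two] at hu
      change (e i : ℤ) ∣ expSum x i u
      rw [expSum_commutator x i hu]; simp
  exact this hs

/-- Modulo `𝔣`, `∂ⱼ(u - 1)` is the exponent sum of `xⱼ` in `u`; the error times the two remaining
factors lies in `𝔣³`. -/
theorem map_fox_trilinear (x : FreeGroupBasis ι F) (j : ι) {A : Type*} [AddCommGroup A]
    {f : MonoidAlgebra ℤ F →+ A} (hf : ∀ a ∈ augIdeal F ^ 3, f a = 0) (u v w : F) :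
    f (fox x j ((gr u - 1) * (gr v - 1) * (gr w - 1)))
      = expSum x j u • f ((gr v - 1) * (gr w - 1)) := by
  have h1 : gr u - 1 ∈ augIdeal F := of_sub_one_mem_augIdeal u
  rw [mul_assoc, fox_mul_of_mem x j h1]
  have h2 : fox x j (gr u - 1) - (expSum x j u : MonoidAlgebra ℤ F) ∈ augIdeal F := by
    rw [mem_augIdeal]; simp [expSum]
  have h3 := hf ((fox x j (gr u - 1) - (expSum x j u : MonoidAlgebra ℤ F)) *
      ((gr v - 1) * (gr w - 1))) (by
    rw [Submodule.pow_succ, Ideal.IsTwoSided.pow_succ, Submodule.pow_one, ← mul_assoc]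
    exact Ideal.mul_mem_mul (Ideal.mul_mem_mul h2 (of_sub_one_mem_augIdeal v))
      (of_sub_one_mem_augIdeal w))
  rw [sub_mul, map_sub, sub_eq_zero] at h3
  rw [h3, ← zsmul_eq_mul, map_zsmul]

end GroupRing

/-! ### Functionals of finite degree evaluated on commutators. -/

section Functionals

variable {F : Type*} [Group F]

local notation "gr" => MonoidAlgebra.of ℤ F

theorem gr_sub_one_mem_of_mem_gamma {n : ℕ} (hn : 1 ≤ n) {w : F} (hw : w ∈ gamma F n) :
    gr w - 1 ∈ augIdeal F ^ n := by
  have h := denom_le_D (⊥ : Subgroup F) hn ((le_sup_right : gamma F n ≤ denom ⊥ n) hw)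
  have hbot : relIdeal (⊥ : Subgroup F) = ⊥ := by
    rw [relIdeal, Ideal.span_eq_bot]
    rintro _ ⟨s, hs, rfl⟩
    rw [Subgroup.mem_bot.1 hs, map_one, sub_self]
  rwa [mem_D, hbot, Ideal.mul_bot, bot_sup_eq] at h

/-- The cross term `(u - 1)(v - 1)` lies in `𝔣ⁿ⁺¹`, so `u ↦ f(u - 1)` is additive on `γ_n`. -/
theorem map_gr_mul_sub_one {A : Type*} [AddCommGroup A] {f : MonoidAlgebra ℤ F →+ A} {n : ℕ}
    (hn : 1 ≤ n) (hf : ∀ a ∈ augIdeal F ^ (n + 1), f a = 0) {u v : F} (hu : u ∈ gamma F n) :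
    f (gr (u * v) - 1) = f (gr u - 1) + f (gr v - 1) := by
  have h : gr (u * v) - 1 = (gr u - 1) * (gr v - 1) + ((gr u - 1) + (gr v - 1)) := by
    rw [map_mul]; noncomm_ring
  rw [h, map_add, map_add, hf, zero_add]
  rw [Submodule.pow_succ]
  exact Ideal.mul_mem_mul (gr_sub_one_mem_of_mem_gamma hn hu) (of_sub_one_mem_augIdeal v)

theorem map_mul_gr {A : Type*} [AddCommGroup A] {f : MonoidAlgebra ℤ F →+ A} {n : ℕ}
    (hf : ∀ a ∈ augIdeal F ^ (n + 1), f a = 0) {a : MonoidAlgebra ℤ F}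
    (ha : a ∈ augIdeal F ^ n) (g : F) : f (a * gr g) = f a := by
  have h : a * gr g = a * (gr g - 1) + a := by noncomm_ring
  rw [h, map_add, hf, zero_add]
  rw [Submodule.pow_succ]
  exact Ideal.mul_mem_mul ha (of_sub_one_mem_augIdeal g)

theorem gr_sub_one_mul_mem {n : ℕ} {a : MonoidAlgebra ℤ F} (ha : a ∈ augIdeal F ^ n) (u : F) :
    (gr u - 1) * a ∈ augIdeal F ^ (n + 1) := by
  rw [Ideal.IsTwoSided.pow_succ]
  exact Ideal.mul_mem_mul (of_sub_one_mem_augIdeal u) ha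

theorem mul_gr_sub_one_mem {n : ℕ} {a : MonoidAlgebra ℤ F} (ha : a ∈ augIdeal F ^ n) (u : F) :
    a * (gr u - 1) ∈ augIdeal F ^ (n + 1) := by
  rw [Submodule.pow_succ]
  exact Ideal.mul_mem_mul ha (of_sub_one_mem_augIdeal u)

theorem gr_sub_one_mem_pow_one (u : F) : gr u - 1 ∈ augIdeal F ^ 1 := by
  rw [Submodule.pow_one]; exact of_sub_one_mem_augIdeal u

theorem map_gr_commutator_sub_one {A : Type*} [AddCommGroup A] {f : MonoidAlgebra ℤ F →+ A} {n : ℕ}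
    (hf : ∀ a ∈ augIdeal F ^ (n + 2), f a = 0) {u v : F} (hu : gr u - 1 ∈ augIdeal F ^ n) :
    f (gr ⁅u, v⁆ - 1) = f ((gr u - 1) * (gr v - 1)) - f ((gr v - 1) * (gr u - 1)) := by
  rw [of_commutator_sub_one, map_mul_gr (n := n + 1) hf, map_sub]
  exact sub_mem (mul_gr_sub_one_mem hu v) (gr_sub_one_mul_mem hu v)

theorem map_gr_triple_commutator_sub_one {A : Type*} [AddCommGroup A]
    {f : MonoidAlgebra ℤ F →+ A} (hf : ∀ a ∈ augIdeal F ^ 4, f a = 0) (u v w : F) :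
    f (gr ⁅⁅u, v⁆, w⁆ - 1)
      = f ((gr u - 1) * (gr v - 1) * (gr w - 1)) - f ((gr v - 1) * (gr u - 1) * (gr w - 1))
        - (f ((gr w - 1) * (gr u - 1) * (gr v - 1))
          - f ((gr w - 1) * (gr v - 1) * (gr u - 1))) := by
  have h2 : gr ⁅u, v⁆ - 1 ∈ augIdeal F ^ 2 := by
    rw [of_commutator_sub_one]
    exact Ideal.mul_mem_right _ _ (sub_mem
      (mul_gr_sub_one_mem (gr_sub_one_mem_pow_one u) v)
      (mul_gr_sub_one_mem (gr_sub_one_mem_pow_one v) u))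
  rw [map_gr_commutator_sub_one (n := 2) hf h2]
  congr 1
  · exact (map_gr_commutator_sub_one (n := 1) (f := f.comp (AddMonoidHom.mulRight (gr w - 1)))
      (fun a ha => hf _ (mul_gr_sub_one_mem ha w)) (gr_sub_one_mem_pow_one u))
  · have := (map_gr_commutator_sub_one (n := 1) (v := v)
      (f := f.comp (AddMonoidHom.mulLeft (gr w - 1)))
      (fun a ha => hf _ (gr_sub_one_mul_mem ha w)) (gr_sub_one_mem_pow_one u))
    simpa only [AddMonoidHom.comp_apply, AddMonoidHom.coe_mulLeft, ← mul_assoc] using this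

section Quadratic

variable {A : Type*} [AddCommGroup A] {q : F → A} {b : F → F → A}

/-- A quadratic function `q` on the group extends linearly to a functional of degree two; on `𝔣²` it
is given by its polarization `b`. -/
theorem addExtend_mul_of_quadratic (h1 : q 1 = 0) (hq : ∀ u v, q (u * v) = q u + q v + b u v)
    (u v : F) : addExtend q ((gr u - 1) * (gr v - 1)) = b u v := by
  have h : (gr u - 1) * (gr v - 1) = gr (u * v) - gr u - gr v + gr 1 := by
    rw [map_mul, map_one]; noncomm_ring
  rw [h, map_add, map_sub, map_sub]
  simp only [addExtend_of, h1, hq]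
  abel

theorem addExtend_cube_of_quadratic (h1 : q 1 = 0) (hq : ∀ u v, q (u * v) = q u + q v + b u v)
    (hb : ∀ u v w, b (u * v) w = b u w + b v w) {a : MonoidAlgebra ℤ F}
    (ha : a ∈ augIdeal F ^ 3) : addExtend q a = 0 := by
  refine map_eq_zero_of_mem_augIdeal_cube (fun u v w => ?_) ha
  have h : (gr u - 1) * (gr v - 1) * (gr w - 1) = (gr (u * v) - 1) * (gr w - 1)
      - (gr u - 1) * (gr w - 1) - (gr v - 1) * (gr w - 1) := by
    rw [map_mul]; noncomm_ring
  rw [h, map_sub, map_sub]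
  simp only [addExtend_mul_of_quadratic h1 hq, hb]
  abel

theorem addExtend_relIdeal {S : Subgroup F} (hS : ∀ g, ∀ s ∈ S, q (g * s) = q g)
    {a : MonoidAlgebra ℤ F} (ha : a ∈ relIdeal S) : addExtend q a = 0 := by
  refine map_eq_zero_of_mem_relIdeal (fun g s hs => ?_) ha
  rw [mul_sub, mul_one, ← map_mul, map_sub, addExtend_of, addExtend_of, hS g s hs, sub_self]

end Quadratic

variable {ι : Type*} [DecidableEq ι] (x : FreeGroupBasis ι F)

theorem fox_mem_pow (j : ι) {n : ℕ} {a : MonoidAlgebra ℤ F} (ha : a ∈ augIdeal F ^ (n + 1)) :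
    fox x j a ∈ augIdeal F ^ n := by
  rw [Ideal.IsTwoSided.pow_succ] at ha
  exact fox_mem_of_mem_mul x j ha

/-- The source of all congruences on elements of `D(n+1, 𝔣𝔰)`: one derivative turns `𝔣𝔰 + 𝔣ⁿ⁺¹` into
`𝔰 + 𝔣ⁿ`. -/
theorem map_fox_eq_zero_of_mem_D (j : ι) {A : Type*} [AddCommGroup A]
    {f : MonoidAlgebra ℤ F →+ A} {S : Subgroup F} {n : ℕ} (hS : ∀ a ∈ relIdeal S, f a = 0)
    (hf : ∀ a ∈ augIdeal F ^ n, f a = 0) {w : F} (hw : w ∈ D (n + 1) (augIdeal F * relIdeal S)) :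
    f (fox x j (gr w - 1)) = 0 := by
  obtain ⟨a, ha, b, hb, hab⟩ := Submodule.mem_sup.1 (mem_D.1 hw)
  rw [← hab, map_add, map_add, hS _ (fox_mem_of_mem_mul x j ha), hf _ (fox_mem_pow x j hb),
    add_zero]

theorem aug_fox_eq_zero_of_mem_sq (i : ι) {a : MonoidAlgebra ℤ F} (ha : a ∈ augIdeal F ^ 2) :
    aug F (fox x i a) = 0 := by
  have := fox_mem_pow x i (n := 1) ha
  rw [Submodule.pow_one] at this
  exact this

theorem aug_fox_fox_mul (i j : ι) (u v : F) :
    aug F (fox x i (fox x j ((gr u - 1) * (gr v - 1)))) = expSum x j u * expSum x i v := by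
  rw [fox_mul_of_mem x j (of_sub_one_mem_augIdeal u), fox_mul, map_add, map_mul,
    mem_augIdeal.1 (of_sub_one_mem_augIdeal v), mul_zero, add_zero, map_zsmul, map_sub,
    map_sub (fox x i), fox_one, fox_one, sub_zero, sub_zero, smul_eq_mul]
  rfl

theorem aug_fox_gr_commutator (i j : ι) (u v : F) :
    aug F (fox x i (fox x j (gr ⁅u, v⁆ - 1)))
      = expSum x j u * expSum x i v - expSum x j v * expSum x i u := by
  have := map_gr_commutator_sub_one (n := 1) (u := u) (v := v)
    (f := (aug F).toAddMonoidHom.comp ((fox x i).comp (fox x j)))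
    (fun a ha => aug_fox_eq_zero_of_mem_sq x i (fox_mem_pow x j ha)) (gr_sub_one_mem_pow_one u)
  rw [← aug_fox_fox_mul, ← aug_fox_fox_mul]
  exact this

end Functionals

/-! ### Congruences modulo the exponents `eᵢ`. -/

section Divisibility

variable {F : Type*} [Group F] {m : ℕ} (x : FreeGroupBasis (Fin m) F) (e : Fin m → ℕ)

local notation "gr" => MonoidAlgebra.of ℤ F

/-- The functional `ε∂ᵢ` reduced modulo `eᵢ` kills `𝔣²`, and it kills `𝔰` because exponent sums of
`xᵢ` on `S` are multiples of `eᵢ`. -/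
theorem dvd_aug_fox_fox (i j : Fin m) {w : F}
    (hw : w ∈ D 3 (augIdeal F * relIdeal (subS x e))) :
    (e i : ℤ) ∣ aug F (fox x i (fox x j (gr w - 1))) := by
  have := map_fox_eq_zero_of_mem_D x j (n := 2) (S := subS x e)
    (f := (Int.castAddHom (ZMod (e i))).comp ((aug F).toAddMonoidHom.comp (fox x i)))
    (fun a ha => map_eq_zero_of_mem_relIdeal (fun g s hs => ?_) ha)
    (fun a ha => by
      have := aug_fox_eq_zero_of_mem_sq x i ha
      change ((aug F (fox x i a) : ℤ) : ZMod (e i)) = 0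
      rw [this, Int.cast_zero]) hw
  · exact (ZMod.intCast_zmod_eq_zero_iff_dvd _ _).1 this
  · change ((aug F (fox x i (gr g * (gr s - 1))) : ℤ) : ZMod (e i)) = 0
    rw [fox_mul, map_add, map_mul, mem_augIdeal.1 (of_sub_one_mem_augIdeal s), mul_zero, add_zero,
      aug_of, one_smul, map_sub, fox_one, sub_zero]
    exact (ZMod.intCast_zmod_eq_zero_iff_dvd _ _).2 (dvd_expSum_of_mem_subS x e i hs)

/-- For `k ≤ i` in the divisibility order there is a functional on `ℤ[F]` which kills `𝔰` and `𝔣³`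
and reads off the coefficient of `Xᵢ Xₖ` in the symmetric square. -/
theorem exists_quadratic_functional (he : ∀ i j : Fin m, i ≤ j → e j ∣ e i) {i k : Fin m}
    (hik : i ≤ k) :
    ∃ (N c : ℕ) (f : MonoidAlgebra ℤ F →+ ZMod N),
      (∀ a ∈ relIdeal (subS x e), f a = 0) ∧ (∀ a ∈ augIdeal F ^ 3, f a = 0) ∧
      (∀ u v, f ((gr u - 1) * (gr v - 1)) =
        ((expSum x i u * expSum x k v + expSum x k u * expSum x i v : ℤ) : ZMod N)) ∧
      c = (if i = k then 2 else 1) ∧ ∀ z : ℤ, ((z * c : ℤ) : ZMod N) = 0 → (e k : ℤ) ∣ z := by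
  have hb : ∀ N : ℕ, ∀ u v w : F,
      ((expSum x i (u * v) * expSum x k w + expSum x k (u * v) * expSum x i w : ℤ) : ZMod N)
      = ((expSum x i u * expSum x k w + expSum x k u * expSum x i w : ℤ) : ZMod N)
        + ((expSum x i v * expSum x k w + expSum x k v * expSum x i w : ℤ) : ZMod N) := by
    intro N u v w
    rw [← Int.cast_add, expSum_mul, expSum_mul]
    congr 1; ring
  rcases eq_or_ne i k with rfl | hne
  -- On the diagonal the polarization of `a²` is `2ab`, so modulus `2eᵢ` is needed to conclude
  -- divisibility by `eᵢ`. Plain `a²` need not be invariant under `a ↦ a + eᵢz` modulo `2eᵢ`; the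
  -- linear term `-eᵢa` repairs this and leaves the polarization unchanged.
  · let q : F → ZMod (2 * e i) := fun w => ((expSum x i w * (expSum x i w - e i) : ℤ) : ZMod _)
    have h1 : q 1 = 0 := by simp [q]
    have hq : ∀ u v, q (u * v) = q u + q v +
        ((expSum x i u * expSum x i v + expSum x i u * expSum x i v : ℤ) : ZMod _) := by
      intro u v
      simp only [q]
      rw [← Int.cast_add, ← Int.cast_add, expSum_mul]
      congr 1; ring
    refine ⟨2 * e i, 2, addExtend q, fun a ha => addExtend_relIdeal (fun g s hs => ?_) ha,
      fun a ha => addExtend_cube_of_quadratic h1 hq (hb _) ha,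
      addExtend_mul_of_quadratic h1 hq, by simp, fun z hz => ?_⟩
    · simp only [q]
      rw [ZMod.intCast_eq_intCast_iff_dvd_sub, expSum_mul]
      obtain ⟨z, hz⟩ := dvd_expSum_of_mem_subS x e i hs
      rw [hz]
      -- The change of `q` is `2aeᵢz + eᵢ²z(z - 1)`, and `z(z - 1)` is even.
      obtain ⟨y, hy⟩ := Int.even_mul_pred_self z
      refine ⟨-(expSum x i g * z + e i * y), ?_⟩
      push_cast
      linear_combination (-(e i : ℤ) * e i) * hy
    · rw [ZMod.intCast_zmod_eq_zero_iff_dvd, Nat.cast_mul, mul_comm z] at hz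
      exact Int.dvd_of_mul_dvd_mul_left (by norm_num) hz
  -- Off the diagonal, `eₖ ∣ eᵢ` makes both exponent sums of an element of `S` vanish modulo `eₖ`.
  · let q : F → ZMod (e k) := fun w => ((expSum x i w * expSum x k w : ℤ) : ZMod _)
    have h1 : q 1 = 0 := by simp [q]
    have hq : ∀ u v, q (u * v) = q u + q v +
        ((expSum x i u * expSum x k v + expSum x k u * expSum x i v : ℤ) : ZMod _) := by
      intro u v
      simp only [q]
      rw [← Int.cast_add, ← Int.cast_add, expSum_mul, expSum_mul]
      congr 1; ring
    refine ⟨e k, 1, addExtend q, fun a ha => addExtend_relIdeal (fun g s hs => ?_) ha,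
      fun a ha => addExtend_cube_of_quadratic h1 hq (hb _) ha,
      addExtend_mul_of_quadratic h1 hq, by simp [hne], fun z hz => ?_⟩
    · simp only [q]
      have hi : (expSum x i s : ZMod (e k)) = 0 :=
        (ZMod.intCast_zmod_eq_zero_iff_dvd _ _).2
          ((Int.natCast_dvd_natCast.2 (he i k hik)).trans (dvd_expSum_of_mem_subS x e i hs))
      have hk : (expSum x k s : ZMod (e k)) = 0 :=
        (ZMod.intCast_zmod_eq_zero_iff_dvd _ _).2 (dvd_expSum_of_mem_subS x e k hs)
      push_cast [expSum_mul, hi, hk]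
      simp
    · rwa [Nat.cast_one, mul_one, ZMod.intCast_zmod_eq_zero_iff_dvd] at hz

end Divisibility

universe u

/-! ### Generators and coordinates for lower central quotients. -/

section LowerCentral

variable {F : Type*} [Group F]

theorem gamma_succ {n : ℕ} (hn : 1 ≤ n) : gamma F (n + 1) = ⁅gamma F n, (⊤ : Subgroup F)⁆ := by
  obtain ⟨k, rfl⟩ := Nat.exists_eq_add_of_le' hn
  exact Subgroup.lowerCentralSeries_succ _ _

theorem gamma_antitone : Antitone (gamma F) := fun _ _ h =>
  Subgroup.lowerCentralSeries_antitone _ (Nat.sub_le_sub_right h 1)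

theorem commutator_mem_gamma_succ {n : ℕ} (hn : 1 ≤ n) {u : F} (hu : u ∈ gamma F n) (v : F) :
    ⁅u, v⁆ ∈ gamma F (n + 1) := by
  rw [gamma_succ hn]
  exact Subgroup.commutator_mem_commutator hu (Subgroup.mem_top v)

theorem commutator_mem_gamma_two (u v : F) : ⁅u, v⁆ ∈ gamma F 2 :=
  commutator_mem_gamma_succ le_rfl (Subgroup.mem_top u) v

/-- An instance of the three subgroups lemma. -/
theorem commutator_gamma_two_eq_bot (h : gamma F 4 = ⊥) : ⁅gamma F 2, gamma F 2⁆ = ⊥ := by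
  have h4 : gamma F 4 = ⁅gamma F 3, (⊤ : Subgroup F)⁆ := gamma_succ (by norm_num)
  have h3 : gamma F 3 = ⁅gamma F 2, (⊤ : Subgroup F)⁆ := gamma_succ (by norm_num)
  have h2 : gamma F 2 = ⁅(⊤ : Subgroup F), (⊤ : Subgroup F)⁆ := gamma_succ (n := 1) le_rfl
  have h' : ⁅⁅gamma F 2, (⊤ : Subgroup F)⁆, (⊤ : Subgroup F)⁆ = ⊥ := by rw [← h3, ← h4, h]
  have key := Subgroup.commutator_commutator_eq_bot_of_rotate (H₁ := (⊤ : Subgroup F))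
    (H₂ := ⊤) (H₃ := gamma F 2) (by rwa [Subgroup.commutator_comm ⊤]) h'
  rwa [← h2] at key

theorem mk_mem_center {n : ℕ} (hn : 1 ≤ n) {u : F} (hu : u ∈ gamma F n) :
    (u : F ⧸ gamma F (n + 1)) ∈ Subgroup.center (F ⧸ gamma F (n + 1)) := by
  rw [Subgroup.mem_center_iff]
  intro g
  induction g using QuotientGroup.induction_on with
  | H g =>
    have h : ((⁅u, g⁆ : F) : F ⧸ gamma F (n + 1)) = 1 :=
      (QuotientGroup.eq_one_iff _).2 (commutator_mem_gamma_succ hn hu g)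
    exact (commutatorElement_eq_one_iff_mul_comm.1 h).symm

/-- `[u, vᵏ] ≡ [u, v]ᵏ` modulo `γ_{n+2}` for `u ∈ γ_n`. -/
theorem mk_commutator_pow {n : ℕ} (hn : 1 ≤ n) {u : F} (hu : u ∈ gamma F n) (v : F) (k : ℕ) :
    ((⁅u, v ^ k⁆ : F) : F ⧸ gamma F (n + 2)) = ((⁅u, v⁆ ^ k : F) : F ⧸ gamma F (n + 2)) := by
  have hc := mk_mem_center (Nat.le_succ_of_le hn) (commutator_mem_gamma_succ hn hu v)
  rw [Subgroup.mem_center_iff] at hc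
  have h1 : u * v * u⁻¹ = ⁅u, v⁆ * v := by simp [commutatorElement_def]
  have h2 : ⁅u, v ^ k⁆ = (⁅u, v⁆ * v) ^ k * (v ^ k)⁻¹ := by
    rw [← h1, conj_pow, commutatorElement_def]
  have h3 : Commute ((⁅u, v⁆ : F) : F ⧸ gamma F (n + 2)) (v : F ⧸ gamma F (n + 2)) :=
    (hc v).symm
  rw [h2, QuotientGroup.mk_mul, QuotientGroup.mk_pow, QuotientGroup.mk_mul, h3.mul_pow,
    QuotientGroup.mk_inv, QuotientGroup.mk_pow, mul_inv_cancel_right, QuotientGroup.mk_pow]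

open scoped IsMulCommutative in
/-- If `γ_n` is generated by a finite family modulo `γ_{n+1}`, each element of `γ_n` has
coordinates with respect to that family. -/
theorem exists_coordinates {T : Type*} [Fintype T] {n : ℕ} (hn : 1 ≤ n) (y : T → F)
    (hy : ∀ t, y t ∈ gamma F n)
    (hgen : gamma F n ≤ Subgroup.closure (Set.range y) ⊔ gamma F (n + 1)) {w : F}
    (hw : w ∈ gamma F n) :
    ∃ c : T → ℤ,
      (∀ M : Subgroup F, gamma F (n + 1) ≤ M → ∀ r : ℤ, (∀ t, y t ^ (r * c t) ∈ M) → w ^ r ∈ M) ∧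
      ∀ (A : Type) [AddCommGroup A] (f : MonoidAlgebra ℤ F →+ A),
        (∀ a ∈ augIdeal F ^ (n + 1), f a = 0) →
        f (MonoidAlgebra.of ℤ F w - 1) = ∑ t, c t • f (MonoidAlgebra.of ℤ F (y t) - 1) := by
  classical
  -- The image of `γ_n` is central in `F/γ_{n+1}`; working inside the centre gives unordered finite
  -- products.
  let y' : T → Subgroup.center (F ⧸ gamma F (n + 1)) := fun t => ⟨y t, mk_mem_center hn (hy t)⟩
  -- Membership in `γ_n` is carried along because additivity of `f` on products depends on it.
  suffices ∃ c : T → ℤ, (w : F ⧸ gamma F (n + 1)) = ((∏ t, y' t ^ c t : Subgroup.center _) : _) ∧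
      w ∈ gamma F n ∧ ∀ (A : Type) [AddCommGroup A] (f : MonoidAlgebra ℤ F →+ A),
        (∀ a ∈ augIdeal F ^ (n + 1), f a = 0) →
        f (MonoidAlgebra.of ℤ F w - 1) = ∑ t, c t • f (MonoidAlgebra.of ℤ F (y t) - 1) by
    obtain ⟨c, hc, -, hc'⟩ := this
    refine ⟨c, fun M hM r hr => ?_, hc'⟩
    let M' := M.map (QuotientGroup.mk' (gamma F (n + 1)))
    have h : ((∏ t, y' t ^ (r * c t) : Subgroup.center _) : F ⧸ gamma F (n + 1)) ∈ M' := by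
      refine (Subgroup.mem_subgroupOf (H := M')).1 (prod_mem fun t _ => ?_)
      exact ⟨_, hr t, by simp [y']⟩
    have h' : ((w ^ r : F) : F ⧸ gamma F (n + 1)) ∈ M' := by
      rw [QuotientGroup.mk_zpow, hc, ← Subgroup.coe_zpow, ← Finset.prod_zpow]
      simpa only [← zpow_mul, mul_comm r] using h
    obtain ⟨v, hv, hvw⟩ := h'
    have := hM (QuotientGroup.eq.1 hvw)
    simpa using M.mul_mem hv this
  have hw' : w ∈ Subgroup.closure (Set.range y ∪ gamma F (n + 1)) := by
    rw [Subgroup.closure_union, Subgroup.closure_eq]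
    exact hgen hw
  clear hw
  induction hw' using Subgroup.closure_induction with
  | mem w hw =>
    rcases hw with ⟨t, rfl⟩ | hw
    · refine ⟨Pi.single t 1, ?_, hy t, fun A _ f _ => ?_⟩
      · rw [Finset.prod_eq_single t (fun s _ hs => by simp [hs]) (by simp)]
        simp [y']
      · rw [Finset.sum_eq_single t (fun s _ hs => by simp [hs]) (by simp)]
        simp
    · refine ⟨0, ?_, gamma_antitone (Nat.le_succ n) hw, fun A _ f hf => ?_⟩
      · simpa using hw
      · rw [hf _ (gr_sub_one_mem_of_mem_gamma (Nat.succ_pos n) hw)]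
        simp
  | one => exact ⟨0, by simp, one_mem _, fun A _ f _ => by rw [map_one, sub_self, map_zero]; simp⟩
  | mul u v _ _ hu hv =>
    obtain ⟨c, hc, hu, hcf⟩ := hu
    obtain ⟨d, hd, hv, hdf⟩ := hv
    refine ⟨c + d, ?_, mul_mem hu hv, fun A _ f hf => ?_⟩
    · simp [hc, hd, zpow_add, Finset.prod_mul_distrib]
    · rw [map_gr_mul_sub_one hn hf hu, hcf A f hf, hdf A f hf, ← Finset.sum_add_distrib]
      simp only [Pi.add_apply, add_smul]
  | inv u _ hu =>
    obtain ⟨c, hc, hu, hcf⟩ := hu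
    refine ⟨-c, ?_, inv_mem hu, fun A _ f hf => ?_⟩
    · simp [hc]
    · have h := map_gr_mul_sub_one hn hf (v := u) (inv_mem hu)
      rw [inv_mul_cancel, map_one, sub_self, map_zero, hcf A f hf] at h
      rw [eq_neg_of_add_eq_zero_left h.symm, ← Finset.sum_neg_distrib]
      simp only [Pi.neg_apply, neg_smul]

/-- Reduces generation of `γ_n` modulo `γ_{n+1}` to a vanishing statement in a quotient. The
subgroup `H` generated by the family and `γ_{n+1}` lies between `γ_{n+1}` and `γ_n`, hence is
normal, and `Q = F/H` is the group to test. -/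
theorem gamma_le_closure_sup {F : Type u} [Group F] {T : Type*} {n : ℕ} (hn : 1 ≤ n) (y : T → F)
    (hy : ∀ t, y t ∈ gamma F n)
    (h : ∀ (Q : Type u) [Group Q] (p : F →* Q), Function.Surjective p → gamma Q (n + 1) = ⊥ →
      (∀ t, p (y t) = 1) → gamma Q n = ⊥) :
    gamma F n ≤ Subgroup.closure (Set.range y) ⊔ gamma F (n + 1) := by
  set H := Subgroup.closure (Set.range y) ⊔ gamma F (n + 1)
  have hle : H ≤ gamma F n := sup_le
    ((Subgroup.closure_le _).2 (by rintro _ ⟨t, rfl⟩; exact hy t)) (gamma_antitone (Nat.le_succ n))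
  have : H.Normal := by
    refine ⟨fun u hu g => ?_⟩
    have h1 : g * u * g⁻¹ = ⁅u, g⁆⁻¹ * u := by simp [commutatorElement_def, mul_assoc]
    rw [h1]
    exact mul_mem (inv_mem (le_sup_right (a := Subgroup.closure (Set.range y))
      (commutator_mem_gamma_succ hn (hle hu) g))) hu
  have hmap : ∀ k, gamma (F ⧸ H) k = (gamma F k).map (QuotientGroup.mk' H) := fun k => by
    rw [gamma, gamma, Subgroup.map_lowerCentralSeries, Subgroup.map_top_of_surjective _
      (QuotientGroup.mk'_surjective H)]
  have hker : ∀ K : Subgroup F, K.map (QuotientGroup.mk' H) = ⊥ ↔ K ≤ H := fun K => by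
    rw [Subgroup.map_eq_bot_iff, QuotientGroup.ker_mk']
  have := h (F ⧸ H) (QuotientGroup.mk' H) (QuotientGroup.mk'_surjective H)
    (by rw [hmap, hker]; exact le_sup_right)
    (fun t => (QuotientGroup.eq_one_iff _).2
      ((le_sup_left : _ ≤ H) (Subgroup.subset_closure ⟨t, rfl⟩)))
  rwa [hmap, hker] at this

theorem gamma_succ_eq_bot {n : ℕ} (hn : 1 ≤ n) (h : ∀ u ∈ gamma F n, u ∈ Subgroup.center F) :
    gamma F (n + 1) = ⊥ := by
  rw [gamma_succ hn, Subgroup.commutator_top_right_eq_bot_iff_le_center]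
  exact h

theorem mem_center_of_commute_generators {X : Set F} (hX : Subgroup.closure X = ⊤) {u : F}
    (h : ∀ a ∈ X, Commute u a) : u ∈ Subgroup.center F := by
  rw [Subgroup.mem_center_iff]
  have : (⊤ : Subgroup F) ≤ Subgroup.centralizer {u} := by
    rw [← hX, Subgroup.closure_le]
    intro a ha
    exact Subgroup.mem_centralizer_singleton_iff.2 (h a ha).symm
  exact fun g => Subgroup.mem_centralizer_singleton_iff.1 (this (Subgroup.mem_top g))

theorem gamma_two_eq_bot_of_generators {X : Set F} (hX : Subgroup.closure X = ⊤)
    (h : ∀ a ∈ X, ∀ b ∈ X, Commute a b) : gamma F 2 = ⊥ := by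
  have hZ : (⊤ : Subgroup F) ≤ Subgroup.center F := by
    rw [← hX, Subgroup.closure_le]
    exact fun a ha => mem_center_of_commute_generators hX (h a ha)
  exact gamma_succ_eq_bot le_rfl fun u _ => hZ (Subgroup.mem_top u)

/-- Commutators of generators are central, so the quotient by the centre is abelian and `γ₂` is
central. -/
theorem gamma_three_eq_bot_of_generators {X : Set F} (hX : Subgroup.closure X = ⊤)
    (h : ∀ a ∈ X, ∀ b ∈ X, ∀ c ∈ X, Commute ⁅a, b⁆ c) : gamma F 3 = ⊥ := by
  let Z := Subgroup.center F
  have h2 : gamma (F ⧸ Z) 2 = ⊥ := by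
    refine gamma_two_eq_bot_of_generators (X := QuotientGroup.mk' Z '' X) ?_ ?_
    · rw [← MonoidHom.map_closure, hX,
        Subgroup.map_top_of_surjective _ (QuotientGroup.mk'_surjective Z)]
    · rintro _ ⟨a, ha, rfl⟩ _ ⟨b, hb, rfl⟩
      rw [← commutatorElement_eq_one_iff_commute, ← map_commutatorElement]
      exact (QuotientGroup.eq_one_iff _).2
        (mem_center_of_commute_generators hX (h a ha b hb))
  refine gamma_succ_eq_bot (by norm_num) fun u hu => ?_
  have hmap : (gamma F 2).map (QuotientGroup.mk' Z) = ⊥ := by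
    rw [← h2, gamma, gamma, Subgroup.map_lowerCentralSeries, Subgroup.map_top_of_surjective _
      (QuotientGroup.mk'_surjective Z)]
  rw [Subgroup.map_eq_bot_iff, QuotientGroup.ker_mk'] at hmap
  exact hmap hu

/-- A form of the Jacobi identity in a group whose commutator subgroup is abelian. -/
theorem commute_commutator_of_commute (h2 : ⁅gamma F 2, gamma F 2⁆ = ⊥) {a b c : F}
    (hac : Commute ⁅a, c⁆ b) (hbc : Commute ⁅b, c⁆ a) : Commute ⁅a, b⁆ c := by
  have hcomm : ∀ u ∈ gamma F 2, ∀ v ∈ gamma F 2, Commute u v := fun u hu v hv => by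
    rw [← commutatorElement_eq_one_iff_commute, ← Subgroup.mem_bot, ← h2]
    exact Subgroup.commutator_mem_commutator hu hv
  set u := ⁅a, c⁆⁻¹ with hu
  set v := ⁅b, c⁆⁻¹ with hv
  have hu2 : u ∈ gamma F 2 := inv_mem (commutator_mem_gamma_two a c)
  have hv2 : v ∈ gamma F 2 := inv_mem (commutator_mem_gamma_two b c)
  have hub : Commute u b := hac.inv_left
  have hva : Commute v a := hbc.inv_left
  have huv : Commute u v := hcomm u hu2 v hv2
  have hab : Commute (u * v) ⁅a, b⁆ :=
    hcomm _ (mul_mem hu2 hv2) _ (commutator_mem_gamma_two a b)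
  have hca : c * a * c⁻¹ = u * a := by simp [hu, commutatorElement_def, mul_assoc]
  have hcb : c * b * c⁻¹ = v * b := by simp [hv, commutatorElement_def, mul_assoc]
  -- Conjugation by `c` sends `a` to `ua` and `b` to `vb`. The commutation rules turn the new
  -- commutator into the conjugate of `[a, b]` by `uv`, and this is `[a, b]` since `γ₂` is abelian.
  have h1 : c * ⁅a, b⁆ * c⁻¹ = ⁅u * a, v * b⁆ := by
    rw [← hca, ← hcb]; simp [commutatorElement_def, mul_assoc]
  have h3 : ⁅u * a, v * b⁆ = (u * v) * ⁅a, b⁆ * (u * v)⁻¹ := by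
    rw [commutatorElement_def, commutatorElement_def, mul_inv_rev, mul_inv_rev, huv.eq,
      mul_inv_rev]
    calc u * a * (v * b) * (a⁻¹ * u⁻¹) * (b⁻¹ * v⁻¹)
        = u * (a * v) * b * a⁻¹ * (u⁻¹ * b⁻¹) * v⁻¹ := by simp only [mul_assoc]
      _ = u * (v * a) * b * a⁻¹ * (b⁻¹ * u⁻¹) * v⁻¹ := by
          rw [hva.eq, (hub.inv_inv).eq]
      _ = (u * v) * (a * b * a⁻¹ * b⁻¹) * (u⁻¹ * v⁻¹) := by simp only [mul_assoc]
      _ = _ := by rw [huv.eq]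
  have h4 : c * ⁅a, b⁆ * c⁻¹ = ⁅a, b⁆ := by
    rw [h1, h3, hab.eq, mul_inv_cancel_right]
  exact (mul_inv_eq_iff_eq_mul.1 h4).symm

/-! ### Basic commutators of weights two and three. -/

section Basis

variable {m : ℕ} (x : FreeGroupBasis (Fin m) F)

theorem closure_image_range {Q : Type*} [Group Q] {p : F →* Q} (hp : Function.Surjective p) :
    Subgroup.closure (p '' Set.range x) = ⊤ := by
  rw [← MonoidHom.map_closure, closure_range_freeGroupBasis, Subgroup.map_top_of_surjective _ hp]

theorem gamma_two_le_closure_sup :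
    gamma F 2 ≤ Subgroup.closure (Set.range fun t : {t : Fin m × Fin m // t.1 < t.2} =>
      ⁅x t.1.2, x t.1.1⁆) ⊔ gamma F 3 := by
  refine gamma_le_closure_sup (by norm_num) _ (fun t => commutator_mem_gamma_two _ _) ?_
  intro Q _ p hp _ hy
  refine gamma_two_eq_bot_of_generators (closure_image_range x hp) ?_
  rintro _ ⟨_, ⟨j, rfl⟩, rfl⟩ _ ⟨_, ⟨i, rfl⟩, rfl⟩
  rcases lt_trichotomy i j with hij | rfl | hij
  · rw [← commutatorElement_eq_one_iff_commute, ← map_commutatorElement]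
    exact hy ⟨(i, j), hij⟩
  · exact Commute.refl _
  · refine Commute.symm ?_
    rw [← commutatorElement_eq_one_iff_commute, ← map_commutatorElement]
    exact hy ⟨(j, i), hij⟩

theorem gamma_three_le_closure_sup :
    gamma F 3 ≤ Subgroup.closure
      (Set.range fun t : {t : Fin m × Fin m × Fin m // t.1 < t.2.1 ∧ t.1 ≤ t.2.2} =>
        ⁅⁅x t.1.2.1, x t.1.1⁆, x t.1.2.2⁆) ⊔ gamma F 4 := by
  refine gamma_le_closure_sup (by norm_num) _
    (fun t => commutator_mem_gamma_succ (by norm_num) (commutator_mem_gamma_two _ _) _) ?_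
  intro Q _ p hp h4 hy
  have h2 := commutator_gamma_two_eq_bot h4
  have basic : ∀ i j k, i < j → i ≤ k → Commute ⁅p (x j), p (x i)⁆ (p (x k)) :=
    fun i j k hij hik => by
      rw [← commutatorElement_eq_one_iff_commute, ← map_commutatorElement,
        ← map_commutatorElement]
      exact hy ⟨(i, j, k), hij, hik⟩
  -- For `k < i < j` the commutator is not basic; the Jacobi identity reduces it to `[[xⱼ, xₖ], xᵢ]`
  -- and `[[xᵢ, xₖ], xⱼ]`, which are.
  have lower : ∀ i j k, i < j → Commute ⁅p (x j), p (x i)⁆ (p (x k)) := fun i j k hij => by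
    rcases le_or_gt i k with hik | hki
    · exact basic i j k hij hik
    · exact commute_commutator_of_commute h2 (basic k j i (hki.trans hij) hki.le)
        (basic k i j hki (hki.trans hij).le)
  refine gamma_three_eq_bot_of_generators (closure_image_range x hp) ?_
  rintro _ ⟨_, ⟨j, rfl⟩, rfl⟩ _ ⟨_, ⟨i, rfl⟩, rfl⟩ _ ⟨_, ⟨k, rfl⟩, rfl⟩
  rcases lt_trichotomy i j with hij | rfl | hij
  · exact lower i j k hij
  · rw [commutatorElement_self]; exact Commute.one_left _
  · rw [← commutatorElement_inv]; exact (lower j i k hij).inv_left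

end Basis

end LowerCentral

/-! ### Injectivity: weight three elements of `D(4, 𝔣𝔰)`. -/

section Main

variable {F : Type*} [Group F] {m : ℕ} (x : FreeGroupBasis (Fin m) F) (e : Fin m → ℕ)

local notation "gr" => MonoidAlgebra.of ℤ F

theorem gamma_two_le_subS : gamma F 2 ≤ subS x e := le_sup_right

theorem basis_pow_mem_subS {i : Fin m} {n : ℕ} (h : e i ∣ n) : x i ^ n ∈ subS x e := by
  obtain ⟨k, rfl⟩ := h
  rw [pow_mul]
  exact pow_mem ((le_sup_left : _ ≤ subS x e) (Subgroup.subset_closure ⟨i, rfl⟩)) k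

/-- The coefficient of a basic triple commutator is read off by the symmetric square functional. -/
theorem basic_triple_coefficient {i j k i' j' k' : Fin m} (hij : i < j) (hik : i ≤ k)
    (hij' : i' < j') (hik' : i' ≤ k') :
    expSum x j (x j') * (expSum x i (x i') * expSum x k (x k')
        + expSum x k (x i') * expSum x i (x k'))
      - expSum x j (x i') * (expSum x i (x j') * expSum x k (x k')
        + expSum x k (x j') * expSum x i (x k'))
    = if i' = i ∧ j' = j ∧ k' = k then (if i = k then 2 else 1) else 0 := by
  simp only [expSum_basis]
  by_cases h1 : j = i'
  · have h2 : i ≠ j' := by omega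
    have h3 : i ≠ k' := by omega
    have h4 : i' ≠ i := by omega
    -- If `j = i'`, then `i` is smaller than both `j'` and `k'`, so the subtracted term vanishes as
    -- well.
    simp [h2, h3, h4, h1.trans_ne hij'.ne]
  · by_cases h2 : j = j'
    · subst h2
      by_cases h3 : i = i'
      · subst h3
        by_cases h4 : k = k'
        · subst h4
          by_cases h5 : i = k
          · subst h5; simp [h1]
          · simp [h1, h5]
        · have h5 : i = k' → ¬ k = i := by omega
          simpa [h1, h4, Ne.symm h4] using h5
      · have h5 : i = k' → ¬ k = i' := by omega
        simpa [h1, h3, Ne.symm h3] using h5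
    · simp [h1, h2, Ne.symm h2]

theorem mem_denom_of_mem_gamma_three (he : ∀ i j : Fin m, i ≤ j → e j ∣ e i) {w : F}
    (hw3 : w ∈ gamma F 3) (hw : w ∈ D 4 (augIdeal F * relIdeal (subS x e))) :
    w ∈ denom (subS x e) 4 := by
  obtain ⟨c, hM, hc⟩ := exists_coordinates (n := 3) (by norm_num) _
    (fun t => commutator_mem_gamma_succ (by norm_num) (commutator_mem_gamma_two _ _) _)
    (gamma_three_le_closure_sup x) hw3
  rw [← zpow_one w]
  refine hM _ le_sup_right 1 ?_
  rintro ⟨⟨i, j, k⟩, hij, hik⟩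
  simp only at hij hik
  set t : {t : Fin m × Fin m × Fin m // t.1 < t.2.1 ∧ t.1 ≤ t.2.2} := ⟨(i, j, k), hij, hik⟩
  obtain ⟨N, d, f, hfS, hf3, hf, hd, hdvd⟩ := exists_quadratic_functional x e he hik
  have hf4 : ∀ a ∈ augIdeal F ^ 4, (f.comp (fox x j)) a = 0 := fun a ha =>
    hf3 _ (fox_mem_pow x j ha)
  have hval : ∀ i' j' k', i' < j' → i' ≤ k' →
      (f.comp (fox x j)) (gr ⁅⁅x j', x i'⁆, x k'⁆ - 1)
        = ((if i' = i ∧ j' = j ∧ k' = k then (d : ℤ) else 0 : ℤ) : ZMod N) := by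
    intro i' j' k' hij' hik'
    -- Of the four terms of the triple commutator, the two beginning with `xₖ'` cancel because the
    -- quadratic form is symmetric.
    rw [map_gr_triple_commutator_sub_one hf4]
    simp only [AddMonoidHom.comp_apply, map_fox_trilinear x j hf3, hf, zsmul_eq_mul]
    have hcoef : (if i' = i ∧ j' = j ∧ k' = k then (d : ℤ) else 0) = _ :=
      Eq.trans (by rw [hd]; push_cast; rfl) (basic_triple_coefficient x hij hik hij' hik').symm
    rw [hcoef]
    push_cast
    ring
  have h0 := hc _ (f.comp (fox x j)) hf4
  have hz : (f.comp (fox x j)) (gr w - 1) = 0 := map_fox_eq_zero_of_mem_D x j hfS hf3 hw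
  rw [hz, Finset.sum_eq_single t] at h0
  rotate_left
  · rintro ⟨⟨i', j', k'⟩, hij', hik'⟩ - hne
    rw [hval i' j' k' hij' hik', if_neg, Int.cast_zero, smul_zero]
    rintro ⟨rfl, rfl, rfl⟩
    exact hne rfl
  · simp
  rw [hval i j k hij hik, if_pos ⟨rfl, rfl, rfl⟩, zsmul_eq_mul, ← Int.cast_mul] at h0
  obtain ⟨z, hz⟩ := hdvd _ h0.symm
  have hS : ⁅⁅x j, x i⁆, x k ^ e k⁆ ∈ ⁅subS x e, subS x e⁆ :=
    Subgroup.commutator_mem_commutator (gamma_two_le_subS x e (commutator_mem_gamma_two _ _))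
      (basis_pow_mem_subS x e dvd_rfl)
  -- Modulo `γ₄(F)` the power can be moved onto the last entry, where `xₖ^eₖ ∈ S`, while `[xⱼ, xᵢ] ∈
  -- γ₂(F) ⊆ S`.
  have hpow : ⁅⁅x j, x i⁆, x k⁆ ^ e k ∈ denom (subS x e) 4 := by
    have h1 := mk_commutator_pow (n := 2) (by norm_num) (commutator_mem_gamma_two (x j) (x i))
      (x k) (e k)
    have h2 := mul_mem (Subgroup.mem_sup_left (T := gamma F 4) hS)
      (Subgroup.mem_sup_right (QuotientGroup.eq.1 h1))
    rwa [mul_inv_cancel_left] at h2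
  change ⁅⁅x j, x i⁆, x k⁆ ^ (1 * c t) ∈ _
  rw [one_mul, hz, zpow_mul, zpow_natCast]
  exact zpow_mem hpow z

/-! ### The cokernel: squares of elements of `D(3, 𝔣𝔰)`. -/

theorem D_three_le_gamma_two : D 3 (augIdeal F * relIdeal (subS x e)) ≤ gamma F 2 := by
  intro w hw
  have hw2 : gr w - 1 ∈ augIdeal F ^ 2 := by
    have hle : augIdeal F * relIdeal (subS x e) ⊔ augIdeal F ^ 3 ≤ augIdeal F ^ 2 := by
      refine sup_le ?_ (Ideal.pow_le_pow_right (by norm_num))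
      rw [Ideal.IsTwoSided.pow_succ, Submodule.pow_one]
      exact Ideal.mul_mono_right (relIdeal_le_augIdeal _)
    exact hle hw
  obtain ⟨c, hM, hc⟩ := exists_coordinates (n := 1) le_rfl x (fun _ => Subgroup.mem_top _)
    (by rw [closure_range_freeGroupBasis]; exact le_top.trans le_sup_left) (Subgroup.mem_top w)
  rw [← zpow_one w]
  -- Each exponent is `ε∂ⱼ(w - 1)`, which vanishes because `w - 1 ∈ 𝔣²`.
  refine hM _ le_rfl 1 fun j => ?_
  have h0 := hc ℤ ((aug F).toAddMonoidHom.comp (fox x j))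
    (fun a ha => aug_fox_eq_zero_of_mem_sq x j ha)
  have hz : ((aug F).toAddMonoidHom.comp (fox x j)) (gr w - 1) = 0 :=
    aug_fox_eq_zero_of_mem_sq x j hw2
  have hl : ∀ l, ((aug F).toAddMonoidHom.comp (fox x j)) (gr (x l) - 1) =
      if j = l then 1 else 0 := fun l => by
    rw [map_sub, ← expSum_basis x j l]
    simp [expSum]
  simp only [hz, hl, smul_eq_mul, mul_ite, mul_one, mul_zero, Finset.sum_ite_eq,
    Finset.mem_univ, if_true] at h0
  rw [← h0, mul_zero, zpow_zero]
  exact one_mem _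

/-- Here `c` is the binomial coefficient `n(n - 1)/2`. The equation for `2c` depends on `n` alone,
so two expansions with the same `n` share the same `c`. -/
theorem exists_binomial_expansion (u : F) (n : ℕ) : ∃ c : ℤ, ∃ r ∈ augIdeal F ^ 3,
    2 * c = n * (n - 1) ∧
      gr (u ^ n) - 1 = n • (gr u - 1) + c • ((gr u - 1) * (gr u - 1)) + r := by
  induction n with
  | zero => exact ⟨0, 0, zero_mem _, by simp, by simp [MonoidAlgebra.one_def]⟩
  | succ n ih =>
    obtain ⟨c, r, hr, hc, h⟩ := ih
    have hcube : (gr u - 1) * (gr u - 1) * (gr u - 1) ∈ augIdeal F ^ 3 :=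
      mul_gr_sub_one_mem (mul_gr_sub_one_mem (gr_sub_one_mem_pow_one u) u) u
    refine ⟨c + n, r * gr u + c • ((gr u - 1) * (gr u - 1) * (gr u - 1)),
      add_mem (Ideal.mul_mem_right _ _ hr) (zsmul_mem hcube _), ?_, ?_⟩
    · push_cast; linear_combination hc
    · have h1 : gr (u ^ (n + 1)) - 1 = (gr (u ^ n) - 1) * gr u + (gr u - 1) := by
        rw [pow_succ, map_mul]; noncomm_ring
      rw [h1, h]
      generalize gr u = a
      simp only [add_smul, one_smul, natCast_zsmul, add_mul, smul_mul_assoc]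
      have h2 : a = (a - 1) + 1 := by abel
      generalize a - 1 = b at *
      subst h2
      simp only [mul_add, mul_one, smul_add]
      abel

theorem isTwoSided_sup {R : Type*} [Ring R] (I J : Ideal R) [I.IsTwoSided] [J.IsTwoSided] :
    (I ⊔ J).IsTwoSided := ⟨fun {a} b ha => by
  obtain ⟨u, hu, v, hv, rfl⟩ := Submodule.mem_sup.1 ha
  rw [add_mul]
  exact add_mem (Submodule.mem_sup_left (Ideal.mul_mem_right _ _ hu))
    (Submodule.mem_sup_right (Ideal.mul_mem_right _ _ hv))⟩

/-- With `n = eᵢ`, `X = xᵢ - 1`, `Y = xⱼ - 1`, only the product `(xᵢⁿ - 1)Y` is not visibly in `𝔣𝔰`.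
Expanding, `nXY` is traded for `X(xⱼⁿ - 1) ∈ 𝔣𝔰`, where `xⱼⁿ ∈ S` because `eⱼ ∣ eᵢ`. The remaining
cubic terms have coefficient `±c`; after doubling it becomes `±n(n - 1)`, and `n` times such a term
lies in `𝔣𝔰 + 𝔣⁴`. -/
theorem sq_commutator_mem_D (he : ∀ i j : Fin m, i ≤ j → e j ∣ e i) {i j : Fin m} (hij : i < j) :
    ⁅x j, x i ^ e i⁆ ^ 2 ∈ D 4 (augIdeal F * relIdeal (subS x e)) := by
  set J := augIdeal F * relIdeal (subS x e) ⊔ augIdeal F ^ 4 with hJ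
  have hJ4 : augIdeal F ^ 4 ≤ J := le_sup_right
  have hJS : ∀ a ∈ augIdeal F, ∀ s ∈ subS x e, a * (gr s - 1) ∈ J := fun a ha s hs =>
    Submodule.mem_sup_left (Ideal.mul_mem_mul ha (sub_one_mem_relIdeal hs))
  have hsi : x i ^ e i ∈ subS x e := basis_pow_mem_subS x e dvd_rfl
  have hsj : x j ^ e i ∈ subS x e := basis_pow_mem_subS x e (he i j hij.le)
  obtain ⟨c, r, hr, hc, hi⟩ := exists_binomial_expansion (x i) (e i)
  obtain ⟨c', r', hr', hc', hj⟩ := exists_binomial_expansion (x j) (e i)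
  obtain rfl : c = c' := by linarith
  set n := e i
  set X := gr (x i) - 1 with hX
  set Y := gr (x j) - 1 with hY
  have mX : X ∈ augIdeal F := of_sub_one_mem_augIdeal _
  have mY : Y ∈ augIdeal F := of_sub_one_mem_augIdeal _
  have mX1 : X ∈ augIdeal F ^ 1 := gr_sub_one_mem_pow_one _
  -- For `a ∈ 𝔣²`, `naY` agrees with `a(xⱼⁿ - 1) ∈ 𝔣𝔰` up to terms of degree at least four.
  have hdeg3 : ∀ a ∈ augIdeal F ^ 2, n • (a * Y) ∈ J := fun a ha => by
    have h1 : n • (a * Y) = a * (gr (x j ^ n) - 1) - c • (a * Y * Y) - a * r' := by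
      rw [hj]
      simp only [mul_add, mul_smul_comm, mul_assoc]
      abel
    rw [h1]
    refine sub_mem (sub_mem (hJS a ?_ _ hsj) (zsmul_mem (hJ4 ?_) c)) (hJ4 ?_)
    · exact Ideal.pow_le_self (by norm_num) ha
    · exact mul_gr_sub_one_mem (mul_gr_sub_one_mem ha _) _
    · have h2 := Ideal.mul_mem_mul ha hr'
      rw [← Ideal.IsTwoSided.pow_add] at h2
      exact Ideal.pow_le_pow_right (by norm_num) h2
  have hc2 : ∀ a ∈ augIdeal F ^ 2, (2 * c) • (a * Y) ∈ J := fun a ha => by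
    rw [hc, mul_comm, mul_smul, natCast_zsmul]
    exact zsmul_mem (hdeg3 a ha) _
  have key : 2 • ((gr (x i ^ n) - 1) * Y) ∈ J := by
    have h1 : (2 : ℕ) • ((gr (x i ^ n) - 1) * Y) = 2 • (X * (gr (x j ^ n) - 1))
        - (2 * c) • (X * Y * Y) - 2 • (X * r') + (2 * c) • (X * X * Y) + 2 • (r * Y) := by
      rw [hi, hj]
      simp only [mul_add, add_mul, mul_smul_comm, smul_mul_assoc, mul_assoc, two_mul, add_smul,
        two_nsmul]
      abel
    rw [h1]
    refine add_mem (add_mem (sub_mem (sub_mem (nsmul_mem (hJS X mX _ hsj) 2) (hc2 _ ?_))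
      (nsmul_mem (hJ4 ?_) 2)) (hc2 _ ?_)) (nsmul_mem (hJ4 ?_) 2)
    · exact mul_gr_sub_one_mem mX1 _
    · exact gr_sub_one_mul_mem hr' _
    · exact mul_gr_sub_one_mem mX1 _
    · exact mul_gr_sub_one_mem hr _
  -- In `g² - 1 = 2(g - 1) + (g - 1)²` the last term is in `𝔣⁴`, as `g` is a commutator.
  have h1 : gr (⁅x j, x i ^ n⁆ ^ 2) - 1 = 2 • (gr ⁅x j, x i ^ n⁆ - 1)
      + (gr ⁅x j, x i ^ n⁆ - 1) * (gr ⁅x j, x i ^ n⁆ - 1) := by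
    rw [map_pow]; noncomm_ring
  have h2 := gr_sub_one_mem_of_mem_gamma (by norm_num) (commutator_mem_gamma_two (x j) (x i ^ n))
  rw [mem_D, h1]
  have : J.IsTwoSided := isTwoSided_sup _ _
  change _ ∈ J
  refine add_mem ?_ (hJ4 ?_)
  · rw [of_commutator_sub_one, ← smul_mul_assoc, smul_sub]
    exact Ideal.mul_mem_right _ _ (sub_mem (nsmul_mem (hJS Y mY _ hsi) 2) key)
  · have := Ideal.mul_mem_mul h2 h2
    rwa [← Ideal.IsTwoSided.pow_add] at this

theorem sq_mem_D_sup (he : ∀ i j : Fin m, i ≤ j → e j ∣ e i) {w : F}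
    (hw : w ∈ D 3 (augIdeal F * relIdeal (subS x e))) :
    w ^ 2 ∈ D 4 (augIdeal F * relIdeal (subS x e)) ⊔ gamma F 3 := by
  obtain ⟨c, hM, hc⟩ := exists_coordinates (n := 2) (by norm_num) _
    (fun t => commutator_mem_gamma_two _ _)
    (gamma_two_le_closure_sup x) (D_three_le_gamma_two x e hw)
  suffices w ^ (2 : ℤ) ∈ D 4 (augIdeal F * relIdeal (subS x e)) ⊔ gamma F 3 by exact_mod_cast this
  refine hM _ le_sup_right 2 ?_
  rintro ⟨⟨i, j⟩, hij⟩
  simp only at hij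
  set t : {t : Fin m × Fin m // t.1 < t.2} := ⟨(i, j), hij⟩
  -- Among the basic commutators of weight two, `ε∂ᵢ∂ⱼ` is nonzero only on `[xⱼ, xᵢ]`, where it
  -- equals `1`.
  have h0 := hc ℤ ((aug F).toAddMonoidHom.comp ((fox x i).comp (fox x j)))
    (fun a ha => aug_fox_eq_zero_of_mem_sq x i (fox_mem_pow x j ha))
  rw [Finset.sum_eq_single t] at h0
  rotate_left
  · rintro ⟨⟨i', j'⟩, hij'⟩ - hne
    have h1 := aug_fox_gr_commutator x i j (x j') (x i')
    simp only [expSum_basis] at h1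
    refine smul_eq_zero_of_right _ (h1.trans ?_)
    have h2 : ¬ (i = j' ∧ j = i') := by
      rintro ⟨rfl, rfl⟩
      exact lt_asymm hij hij'
    have h3 : ¬ (i = i' ∧ j = j') := by
      rintro ⟨rfl, rfl⟩
      exact hne rfl
    simp [← ite_and, h2, h3]
  · simp
  have h1 := aug_fox_gr_commutator x i j (x j) (x i)
  simp only [expSum_basis, if_true, if_neg hij.ne, if_neg hij.ne', mul_zero, sub_zero,
    mul_one] at h1
  have h2 : aug F (fox x i (fox x j (gr w - 1))) = c t :=
    h0.trans ((congrArg (c t • ·) h1).trans (mul_one _))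
  obtain ⟨z, hz⟩ := dvd_aug_fox_fox x e i j hw
  rw [h2] at hz
  have h3 : (⁅x j, x i⁆ ^ e i) ^ 2 ∈ D 4 (augIdeal F * relIdeal (subS x e)) ⊔ gamma F 3 := by
    have h4 := mk_commutator_pow le_rfl (Subgroup.mem_top (x j)) (x i) (e i)
    have h5 : ((⁅x j, x i ^ e i⁆ ^ 2 : F) : F ⧸ gamma F 3)
        = (((⁅x j, x i⁆ ^ e i) ^ 2 : F) : F ⧸ gamma F 3) := by
      rw [QuotientGroup.mk_pow, h4, ← QuotientGroup.mk_pow]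
    have h6 := mul_mem (Subgroup.mem_sup_left (sq_commutator_mem_D x e he hij))
      (Subgroup.mem_sup_right (QuotientGroup.eq.1 h5))
    rwa [mul_inv_cancel_left] at h6
  have h7 : ⁅x j, x i⁆ ^ (2 * c t) = ((⁅x j, x i⁆ ^ e i) ^ 2) ^ z := by
    rw [hz, ← pow_mul, ← zpow_natCast, ← zpow_mul]
    congr 1; push_cast; ring
  change ⁅x j, x i⁆ ^ (2 * c t) ∈ _
  rw [h7]
  exact zpow_mem h3 z

/-! ### Passage to the quotient groups and `θ`. -/

theorem DQuot_three_mul_comm (a b : DQuot (subS x e) 3) : a * b = b * a := by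
  induction a using QuotientGroup.induction_on with
  | H u =>
  induction b using QuotientGroup.induction_on with
  | H v =>
  rw [← QuotientGroup.mk_mul, ← QuotientGroup.mk_mul, QuotientGroup.eq, Subgroup.mem_subgroupOf]
  have h : ((u * v)⁻¹ * (v * u) : F) = ⁅(v⁻¹ : F), (u⁻¹ : F)⁆ := by
    simp [commutatorElement_def, mul_assoc]
  refine Subgroup.mem_sup_right ?_
  change ((u * v)⁻¹ * (v * u) : F) ∈ gamma F 3
  rw [h]
  exact commutator_mem_gamma_succ (by norm_num)
    (inv_mem (D_three_le_gamma_two x e v.2)) _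

theorem DQuot_mk_eq_one_iff {S : Subgroup F} [S.Normal] {n : ℕ}
    (w : D n (augIdeal F * relIdeal S)) : (w : DQuot S n) = 1 ↔ (w : F) ∈ denom S n := by
  rw [QuotientGroup.eq_one_iff, Subgroup.mem_subgroupOf]

theorem theta_mk {S : Subgroup F} [S.Normal] (w : D 4 (augIdeal F * relIdeal S)) :
    theta S (w : DQuot S 4) =
      (Subgroup.inclusion (D_four_le_three (augIdeal F * relIdeal S)) w : DQuot S 3) :=
  QuotientGroup.map_mk _ _ _ _ _

theorem mem_denom_four (he : ∀ i j : Fin m, i ≤ j → e j ∣ e i) {w : F}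
    (hw : w ∈ D 4 (augIdeal F * relIdeal (subS x e))) (hw3 : w ∈ denom (subS x e) 3) :
    w ∈ denom (subS x e) 4 := by
  obtain ⟨u, hu, v, hv, rfl⟩ := Subgroup.mem_sup_of_normal_right.1 hw3
  have hu4 : u ∈ denom (subS x e) 4 := Subgroup.mem_sup_left hu
  -- The factor `u ∈ γ₂(S)` already lies in `D(4, 𝔣𝔰)`, so the factor `v ∈ γ₃(F)` does too.
  have hv4 := mul_mem (inv_mem (denom_le_D (subS x e) (by norm_num) hu4)) hw
  rw [inv_mul_cancel_left] at hv4
  exact mul_mem hu4 (mem_denom_of_mem_gamma_three x e he hv hv4)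

theorem theta_injective (he : ∀ i j : Fin m, i ≤ j → e j ∣ e i) :
    Function.Injective (theta (subS x e)) := by
  rw [injective_iff_map_eq_one]
  intro a ha
  induction a using QuotientGroup.induction_on with
  | H w =>
  rw [theta_mk, DQuot_mk_eq_one_iff, Subgroup.coe_inclusion] at ha
  rw [DQuot_mk_eq_one_iff]
  exact mem_denom_four x e he w.2 ha

theorem sq_mem_range_theta (he : ∀ i j : Fin m, i ≤ j → e j ∣ e i) (a : DQuot (subS x e) 3) :
    a ^ 2 ∈ (theta (subS x e)).range := by
  induction a using QuotientGroup.induction_on with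
  | H w =>
  obtain ⟨u, hu, v, hv, huv⟩ := Subgroup.mem_sup_of_normal_right.1 (sq_mem_D_sup x e he w.2)
  refine ⟨((⟨u, hu⟩ : D 4 (augIdeal F * relIdeal (subS x e))) : DQuot (subS x e) 4), ?_⟩
  change ((⟨u, D_four_le_three _ hu⟩ : D 3 (augIdeal F * relIdeal (subS x e))) :
    DQuot (subS x e) 3) = _
  rw [← QuotientGroup.mk_pow, QuotientGroup.eq, Subgroup.mem_subgroupOf]
  refine Subgroup.mem_sup_right ?_
  change u⁻¹ * (w : F) ^ 2 ∈ gamma F 3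
  rwa [← huv, inv_mul_cancel_left]

end Main

end GenDim

theorem mainTheorem11 {F : Type*} [Group F] {m : ℕ} (x : FreeGroupBasis (Fin m) F)
    (e : Fin m → ℕ) (he : ∀ i j : Fin m, i ≤ j → e j ∣ e i) :
    Function.Injective (GenDim.theta (GenDim.subS x e)) ∧
      (GenDim.theta (GenDim.subS x e)).range.Normal ∧
      GenDim.IsElementaryAbelianTwo (GenDim.Coker (GenDim.theta (GenDim.subS x e))) := by
  have hcomm := GenDim.DQuot_three_mul_comm x e
  refine ⟨GenDim.theta_injective x e he, ⟨fun a ha g => ?_⟩, fun a b => ?_, fun a => ?_⟩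
  · rwa [hcomm g a, mul_inv_cancel_right]
  · induction a using QuotientGroup.induction_on with
    | H a =>
    induction b using QuotientGroup.induction_on with
    | H b => rw [← QuotientGroup.mk_mul, ← QuotientGroup.mk_mul, hcomm]
  · induction a using QuotientGroup.induction_on with
    | H a =>
    rw [← QuotientGroup.mk_pow]
    exact (QuotientGroup.eq_one_iff _).2
      (Subgroup.subset_normalClosure (GenDim.sq_mem_range_theta x e he a))
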